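/- Let $d\ge 1$, let $\mathcal A$ be a finite alphabet with at least two letters, and let $\mathbf q\in\mathbb Z^d$ with $q_i>1$ for all $i$. Operations and inequalities on $\mathbb Z^d$ are coordinatewise, $[\mathbf 0,\mathbf q^n)=\{\mathbf j\in\mathbb Z^d: 0\le j_i<q_i^n \text{ for all } i\}$, and $\lfloor \mathbf k\rfloor_n$ denotes the coordinatewise quotient of $\mathbf k\in\mathbb Z^d$ modulo $\mathbf q^n$ (so $\mathbf k-\lfloor \mathbf k\rfloor_n\mathbf q^n\in[\mathbf 0,\mathbf q^n)$). A block is a map $\omega$ from a finite set $\mathrm{supp}(\omega)\subset\mathbb Z^d$ to $\mathcal A$; write $\omega\le x$ if the block or sequence $x$ extends $\omega$ as a function. The shift is $(T^{\mathbf k}x)(\mathbf j)=x(\mathbf j+\mathbf k)$, on sequences $x\in\mathcal A^{\mathbb Z^d}$ and on blocks. A $\mathbf q$-substitution $\mathcal S$ assigns to each letter $\alpha$ a block $\mathcal S(\alpha)$ with support $[\mathbf 0,\mathbf q)$. It acts on sequences and blocks by $(\mathcal S x)(\mathbf b+\mathbf a\mathbf q)=\mathcal S(x(\mathbf a))(\mathbf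 b)$ for $\mathbf b\in[\mathbf 0,\mathbf q)$ and every $\mathbf a$ in the domain of $x$. Its subshift $X_{\mathcal S}$ is the set, with the topology of pointwise convergence ($\mathcal A$ discrete), of all $x\in\mathcal A^{\mathbb Z^d}$ such that every block having a translate extended by $x$ also has a translate extended by $\mathcal S^n(\gamma)$ for some $n\ge 0$ and some letter $\gamma$ (viewed as the block $\mathbf 0\mapsto\gamma$). $\mathcal S$ is aperiodic if $T^{\mathbf k}x=x$ with $x\in X_{\mathcal S}$ implies $\mathbf k=\mathbf 0$. Write $[\omega]=\{x\in X_{\mathcal S}:\omega\le x\}$, and $[\alpha]$ for the cylinder of the block $\mathbf 0\mapsto\alpha$. The $n$-th desubstitutes of a block $\omega$ are $$\mathcal S^{-n}(\omega)=\{(\mathbf j,\eta): \mathbf j\in[\mathbf 0,\mathbf q^n),\ \eta\text{ a block},\ \mathrm{supp}(\eta)=\lfloor \mathbf j+\mathrm{supp}(\omega)\rfloor_n,\ \omega\le T^{\mathbf j}\mathcal S^n(\eta)\}.$$ Corollary (topological structure). Let $\mathcal S$ be an aperiodic $\mathbf q$-substitution on $\mathcal A$. 1. For every $\mathbf j\in\mathbb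 Z^d$, the map $T^{\mathbf j}\mathcal S$ maps $X_{\mathcal S}$ into itself, and $T^{\mathbf j}\mathcal S:X_{\mathcal S}\to X_{\mathcal S}$ is a topological embedding. 2. For every $n\ge 0$, the $n$-th iterated initial cylinders $T^{\mathbf j}\mathcal S^n[\alpha]$, $\mathbf j\in[\mathbf 0,\mathbf q^n)$, $\alpha\in\mathcal A$, partition $X_{\mathcal S}$: sets with distinct indices $(\mathbf j,\alpha)$ are disjoint, their union is $X_{\mathcal S}$, and $T^{\mathbf j}\mathcal S^n[\alpha]$ is nonempty exactly when $[\alpha]$ is (that is, when $\alpha$ occurs in some sequence of $X_{\mathcal S}$). 3. For every $n\ge 0$ and every block $\omega$, $[\omega]=\bigsqcup_{(\mathbf j,\eta)\in\mathcal S^{-n}(\omega)}T^{\mathbf j}\mathcal S^n[\eta]$, a disjoint union. -/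

import Mathlib

namespace QSubst

/-- Indices: elements of `ℤ^d`, with all operations coordinatewise. -/
abbrev Idx (d : ℕ) : Type := Fin d → ℤ

/-- Sequences over the alphabet `A`, indexed by `ℤ^d`; the topology is the product topology. -/
abbrev Seq (d : ℕ) (A : Type*) : Type _ := Idx d → A

/-- The semi-rectangle `[0, q^n)` in `ℤ^d`. -/
def box {d : ℕ} (q : Idx d) (n : ℕ) : Set (Idx d) :=
  {j | ∀ i, 0 ≤ j i ∧ j i < q i ^ n}

/-- The coordinatewise quotient modulo `q^n`. -/
def quo {d : ℕ} (q : Idx d) (n : ℕ) (k : Idx d) : Idx d := fun i => k i / q i ^ n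

/-- The coordinatewise remainder modulo `q^n`. -/
def rmd {d : ℕ} (q : Idx d) (n : ℕ) (k : Idx d) : Idx d := fun i => k i % q i ^ n

theorem box_finite {d : ℕ} (q : Idx d) (n : ℕ) : (box q n).Finite := by
  refine (Set.Finite.pi (fun i => Set.finite_Ico (0 : ℤ) (q i ^ n))).subset ?_
  intro j hj i _
  exact hj i

theorem rmd_mem_box {d : ℕ} {q : Idx d} (hq : ∀ i, 1 < q i) (n : ℕ) (k : Idx d) :
    rmd q n k ∈ box q n := by
  intro i
  have h : 0 < q i ^ n := pow_pos (lt_trans zero_lt_one (hq i)) n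
  exact ⟨Int.emod_nonneg _ h.ne', Int.emod_lt_of_pos _ h⟩

/-- A block: a partial function from `ℤ^d` to `A` with finite domain
(`none` means that the block is undefined at that index). -/
@[ext] structure Block (d : ℕ) (A : Type*) where
  val : Idx d → Option A
  finite_dom : {k | val k ≠ none}.Finite

namespace Block

variable {d : ℕ} {A : Type*}

/-- The domain of a block. -/
def supp (ω : Block d A) : Set (Idx d) := {k | ω.val k ≠ none}

/-- `ω` is extended by the block `η`. -/
def ExtBlock (ω η : Block d A) : Prop := ∀ k α, ω.val k = some α → η.val k = some α

/-- `ω` is extended by the sequence `x`. -/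
def ExtSeq (ω : Block d A) (x : Seq d A) : Prop := ∀ k α, ω.val k = some α → x k = α

/-- The translate `T^k ω`, given by `(T^k ω)(j) = ω(j + k)`. -/
def shift (k : Idx d) (ω : Block d A) : Block d A where
  val j := ω.val (j + k)
  finite_dom := ω.finite_dom.preimage (add_left_injective k).injOn

open Classical in
/-- The block `0 ↦ α`. -/
noncomputable def letter (α : A) : Block d A where
  val j := if j = 0 then some α else none
  finite_dom := (Set.finite_singleton (0 : Idx d)).subset (by
    intro j hj
    by_contra h
    exact hj (if_neg h))

end Block

/-- The shift `T^k` on sequences, `(T^k x)(j) = x(j + k)`. -/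
def shift {d : ℕ} {A : Type*} (k : Idx d) (x : Seq d A) : Seq d A := fun j => x (j + k)

/-- A `q`-substitution (`q > 1` in each coordinate): it replaces every letter by a block with
support `[0, q)`. -/
structure QSubstitution {d : ℕ} (q : Idx d) (A : Type*) where
  one_lt : ∀ i, 1 < q i
  toBlock : A → box q 1 → A

namespace QSubstitution

variable {d : ℕ} {q : Idx d} {A : Type*}

/-- The letter at position `k mod q` of the block substituted for `α`. -/
def instr (S : QSubstitution q A) (k : Idx d) (α : A) : A :=
  S.toBlock α ⟨rmd q 1 k, rmd_mem_box S.one_lt 1 k⟩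

/-- Action of `S` on sequences: the letter at `a` is replaced by its block, placed on
`a q + [0, q)`. -/
def onSeq (S : QSubstitution q A) (x : Seq d A) : Seq d A :=
  fun k => S.instr k (x (quo q 1 k))

/-- Action of `S` on blocks: the letter at `a` is replaced by its block, placed on
`a q + [0, q)`. -/
def onBlock (S : QSubstitution q A) (ω : Block d A) : Block d A where
  val k := (ω.val (quo q 1 k)).map (S.instr k)
  finite_dom := by
    refine (Set.Finite.image2 (fun a b : Idx d => b + a * q) ω.finite_dom
      (box_finite q 1)).subset ?_
    intro k hk
    refine ⟨quo q 1 k, ?_, rmd q 1 k, rmd_mem_box S.one_lt 1 k, ?_⟩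
    · intro h
      exact hk (by simp [h])
    · funext i
      simp only [Pi.add_apply, Pi.mul_apply, rmd, quo, pow_one]
      exact Int.emod_add_ediv_mul (k i) (q i)

/-- The language of `S`: all blocks of which some translate is extended by some `S^n(γ)`. -/
def language (S : QSubstitution q A) : Set (Block d A) :=
  {ω | ∃ (n : ℕ) (γ : A) (k : Idx d), (ω.shift k).ExtBlock (S.onBlock^[n] (Block.letter γ))}

/-- The substitution subshift `X_S`: all sequences all of whose subblocks are in the language. -/
def subshift (S : QSubstitution q A) : Set (Seq d A) :=
  {x | ∀ ω : Block d A, (∃ k : Idx d, (ω.shift k).ExtSeq x) → ω ∈ S.language}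

/-- `S` is aperiodic: no element of `X_S` has a nonzero period. -/
def Aperiodic (S : QSubstitution q A) : Prop :=
  ∀ x ∈ S.subshift, ∀ k : Idx d, shift k x = x → k = 0

/-- The cylinder `[ω]` in `X_S`. -/
def cylinder (S : QSubstitution q A) (ω : Block d A) : Set (Seq d A) :=
  {x | x ∈ S.subshift ∧ ω.ExtSeq x}

/-- The map `T^j S^n` on sequences. -/
def shiftIter (S : QSubstitution q A) (j : Idx d) (n : ℕ) (x : Seq d A) : Seq d A :=
  shift j (S.onSeq^[n] x)

/-- The iterated cylinder `T^j S^n [η]`. -/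
def iterCylinder (S : QSubstitution q A) (j : Idx d) (n : ℕ) (η : Block d A) : Set (Seq d A) :=
  S.shiftIter j n '' S.cylinder η

/-- The `n`-th desubstitutes of `ω`: pairs `(j, η)` with `j ∈ [0, q^n)`, where `supp η` is the set
of quotients mod `q^n` of the elements of `j + supp ω`, and `ω` is extended by `T^j S^n(η)`. -/
def desubstitutes (S : QSubstitution q A) (n : ℕ) (ω : Block d A) : Set (Idx d × Block d A) :=
  {p | p.1 ∈ box q n ∧ p.2.supp = (fun k => quo q n (p.1 + k)) '' ω.supp ∧
    ω.ExtBlock ((S.onBlock^[n] p.2).shift p.1)}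

end QSubstitution

end QSubst

/-! The core is recognizability (`shiftIter_eq_shiftIter`): a point of the subshift has exactly one
`n`-th desubstitution. Existence (`exists_eq_shiftIter`) is a compactness argument and needs no
aperiodicity. The decompositions into cylinders follow formally, and the embedding follows from
injectivity and compactness.

For uniqueness of the position, suppose `S^m x = T^k S^m x'`. Desubstituting further gives similar
equations at all higher levels, with shifts congruent to `k` modulo `q^m`. Two levels with the same
finite local data, once compared, give a word `S^n(β)` a period that is small relative to its size.
Such a period must vanish (`exists_uniform_level_period_eq_zero`): otherwise it propagates to
arbitrarily large words and, in the limit, to a point of the subshift. Its vanishing says that `k`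
is divisible by `q^m`.

Distinct letters may still have equal images; `onSeq_injOn` handles this, because the
identifications made by `S^n` stabilize in `n`. -/

open Filter

namespace QSubst

/-! ### Euclidean division by `q^n` -/

section Arithmetic

variable {d : ℕ} {q : Idx d}

theorem quo_mul_add_rmd (n : ℕ) (k : Idx d) : quo q n k * q ^ n + rmd q n k = k := by
  funext i
  exact Int.ediv_mul_add_emod (k i) (q i ^ n)

theorem quo_add_mul (hq : ∀ i, 1 < q i) (n : ℕ) (k a : Idx d) :
    quo q n (k + a * q ^ n) = quo q n k + a := by
  funext i
  have h : (q i ^ n) ≠ 0 := (pow_pos (lt_trans zero_lt_one (hq i)) n).ne'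
  exact Int.add_mul_ediv_right _ _ h

theorem rmd_add_mul (n : ℕ) (k a : Idx d) : rmd q n (k + a * q ^ n) = rmd q n k := by
  funext i
  exact Int.add_mul_emod_self_right _ _ _

theorem quo_quo (hq : ∀ i, 1 < q i) (m n : ℕ) (k : Idx d) :
    quo q m (quo q n k) = quo q (n + m) k := by
  funext i
  have h : 0 ≤ (q i ^ n) := (pow_pos (lt_trans zero_lt_one (hq i)) n).le
  simp only [quo, pow_add]
  exact Int.ediv_ediv_of_nonneg h

theorem quo_eq_zero_iff (hq : ∀ i, 1 < q i) {n : ℕ} {k : Idx d} : quo q n k = 0 ↔ k ∈ box q n := by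
  have h : ∀ i, 0 < (q i ^ n) := fun i => pow_pos (lt_trans zero_lt_one (hq i)) n
  constructor
  · intro h0
    have e := quo_mul_add_rmd (q := q) n k
    rw [h0, zero_mul, zero_add] at e
    rw [← e]
    exact rmd_mem_box hq n k
  · intro hk
    funext i
    exact Int.ediv_eq_zero_of_lt (hk i).1 (hk i).2

theorem quo_zero (k : Idx d) : quo q 0 k = k := by
  funext i
  simp [quo]

theorem rmd_eq_self {n : ℕ} {k : Idx d} (hk : k ∈ box q n) : rmd q n k = k := by
  funext i
  exact Int.emod_eq_of_lt (hk i).1 (hk i).2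

theorem quo_mem_box (hq : ∀ i, 1 < q i) {n m : ℕ} {k : Idx d} :
    quo q n k ∈ box q m ↔ k ∈ box q (n + m) := by
  rw [← quo_eq_zero_iff hq, ← quo_eq_zero_iff hq, quo_quo hq]

theorem quo_mul (hq : ∀ i, 1 < q i) (n : ℕ) (a : Idx d) : quo q n (a * q ^ n) = a := by
  funext i
  exact Int.mul_ediv_cancel _ (pow_pos (lt_trans zero_lt_one (hq i)) n).ne'

theorem zero_mem_box (hq : ∀ i, 1 < q i) (n : ℕ) : (0 : Idx d) ∈ box q n := fun i =>
  ⟨le_rfl, pow_pos (lt_trans zero_lt_one (hq i)) n⟩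

end Arithmetic

theorem shift_shift {d : ℕ} {A : Type*} (a b : Idx d) (x : Seq d A) :
    shift a (shift b x) = shift (a + b) x := by
  funext j
  simp [shift, add_assoc]

theorem shift_zero {d : ℕ} {A : Type*} (x : Seq d A) : shift 0 x = x := by
  funext j
  simp [shift]

/-- Pointwise limits along an ultrafilter exist for a finite alphabet. -/
theorem exists_ultrafilter_limit {ι J A : Type*} [Finite A] (U : Ultrafilter ι) (u : ι → J → A) :
    ∃ y : J → A, ∀ z, ∀ᶠ i in (U : Filter ι), u i z = y z := by
  have h : ∀ z, ∃ α, ∀ᶠ i in (U : Filter ι), u i z = α := fun z =>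
    Ultrafilter.eventually_exists_iff.1 (Eventually.of_forall fun i => ⟨u i z, rfl⟩)
  choose y hy using h
  exact ⟨y, hy⟩

/-! ### Letters of iterated words -/

namespace QSubstitution

variable {d : ℕ} {q : Idx d} {A : Type*} (S : QSubstitution q A)

/-- The letter of `S^n(α)` at the position `k mod q^n`. -/
def wordAt (n : ℕ) (k : Idx d) (α : A) : A := (S.onSeq^[n] fun _ => α) k

theorem wordAt_zero (k : Idx d) (α : A) : S.wordAt 0 k α = α := rfl

theorem wordAt_succ (n : ℕ) (k : Idx d) (α : A) :
    S.wordAt (n + 1) k α = S.instr k (S.wordAt n (quo q 1 k) α) := by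
  simp only [wordAt, Function.iterate_succ_apply', onSeq]

theorem onSeq_iterate_apply (n : ℕ) (x : Seq d A) (k : Idx d) :
    (S.onSeq^[n] x) k = S.wordAt n k (x (quo q n k)) := by
  induction n generalizing k with
  | zero => simp [wordAt_zero, quo_zero]
  | succ n ih =>
    rw [Function.iterate_succ_apply', wordAt_succ, add_comm n 1, ← quo_quo S.one_lt, ← ih]
    rfl

theorem onBlock_iterate_val (n : ℕ) (ω : Block d A) (k : Idx d) :
    (S.onBlock^[n] ω).val k = (ω.val (quo q n k)).map (S.wordAt n k) := by
  induction n generalizing k with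
  | zero =>
    have : S.wordAt 0 k = id := rfl
    simp [this, quo_zero]
  | succ n ih =>
    rw [Function.iterate_succ_apply']
    simp only [onBlock, ih]
    rw [quo_quo S.one_lt, add_comm 1 n, Option.map_map]
    congr 1
    funext α
    exact (S.wordAt_succ n k α).symm

theorem onSeq_iterate_shift (n : ℕ) (a : Idx d) (x : Seq d A) :
    S.onSeq^[n] (shift a x) = shift (a * q ^ n) (S.onSeq^[n] x) := by
  induction n generalizing a x with
  | zero => simp
  | succ n ih =>
    have h1 : ∀ (a : Idx d) (x : Seq d A), S.onSeq (shift a x) = shift (a * q) (S.onSeq x) := by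
      intro a x
      funext k
      have e1 : quo q 1 (k + a * q) = quo q 1 k + a := by
        simpa using quo_add_mul S.one_lt 1 k a
      have e2 : rmd q 1 (k + a * q) = rmd q 1 k := by
        simpa using rmd_add_mul (q := q) 1 k a
      simp only [onSeq, shift, instr, e1, e2]
    rw [Function.iterate_succ_apply, h1, ih, Function.iterate_succ_apply, pow_succ']
    congr 1
    ring

/-- A constant sequence is shift-invariant, so its image under `S^n` has all periods in `q^n ℤ^d`.
-/
theorem wordAt_add_mul (n : ℕ) (k a : Idx d) (α : A) :
    S.wordAt n (k + a * q ^ n) α = S.wordAt n k α := by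
  have h := congrFun (S.onSeq_iterate_shift n a fun _ => α) k
  exact h.symm

theorem wordAt_rmd (n : ℕ) (k : Idx d) (α : A) :
    S.wordAt n (rmd q n k) α = S.wordAt n k α := by
  conv_rhs => rw [← quo_mul_add_rmd (q := q) n k, add_comm, wordAt_add_mul]

theorem wordAt_add (n m : ℕ) (k : Idx d) (α : A) :
    S.wordAt (n + m) k α = S.wordAt n k (S.wordAt m (quo q n k) α) := by
  rw [wordAt, Function.iterate_add_apply, onSeq_iterate_apply]
  rfl

theorem onBlock_iterate_letter {n : ℕ} {γ α : A} {k : Idx d} :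
    (S.onBlock^[n] (Block.letter γ)).val k = some α ↔ k ∈ box q n ∧ S.wordAt n k γ = α := by
  rw [onBlock_iterate_val]
  by_cases h : k ∈ box q n
  · simp [Block.letter, (quo_eq_zero_iff S.one_lt).2 h, h]
  · simp [Block.letter, mt (quo_eq_zero_iff S.one_lt).1 h, h]

/-! ### The subshift through finite windows, and existence of desubstitutions -/

/-- A sequence is in the subshift iff each of its finite windows occurs in some `S^n(γ)`. -/
theorem mem_subshift_iff {x : Seq d A} :
    x ∈ S.subshift ↔ ∀ F : Finset (Idx d), ∃ (n : ℕ) (γ : A) (k : Idx d),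
      ∀ i ∈ F, i + k ∈ box q n ∧ S.wordAt n (i + k) γ = x i := by
  classical
  constructor
  · intro hx F
    let ω : Block d A := ⟨fun j => if j ∈ F then some (x j) else none,
      F.finite_toSet.subset fun j hj => by
        by_contra h
        exact hj (if_neg h)⟩
    obtain ⟨n, γ, k, h⟩ := hx ω ⟨0, by
      intro j α hj
      simp only [Block.shift, ω, add_zero] at hj
      split_ifs at hj
      exact Option.some.inj hj⟩
    refine ⟨n, γ, -k, fun i hi => ?_⟩
    have := h (i + -k) (x i) (by simp [Block.shift, ω, hi])
    exact (S.onBlock_iterate_letter).1 this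
  · rintro hx ω ⟨k, hk⟩
    obtain ⟨n, γ, l, h⟩ := hx (ω.shift k).finite_dom.toFinset
    refine ⟨n, γ, k - l, fun j α hj => ?_⟩
    have hj' : (ω.shift k).val (j - l) = some α := by
      rw [← hj]
      simp only [Block.shift]
      congr 1
      ring
    have := h (j - l) (by simp [hj'])
    rw [sub_add_cancel, hk _ _ hj'] at this
    exact (S.onBlock_iterate_letter).2 this

theorem shift_mem_subshift {x : Seq d A} (hx : x ∈ S.subshift) (a : Idx d) :
    shift a x ∈ S.subshift := by
  rw [mem_subshift_iff] at hx ⊢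
  intro F
  obtain ⟨n, γ, k, h⟩ := hx (F.image (· + a))
  refine ⟨n, γ, a + k, fun i hi => ?_⟩
  rw [← add_assoc]
  exact h (i + a) (Finset.mem_image_of_mem _ hi)

theorem onSeq_iterate_mem_subshift {x : Seq d A} (hx : x ∈ S.subshift) (n : ℕ) :
    S.onSeq^[n] x ∈ S.subshift := by
  rw [mem_subshift_iff] at hx ⊢
  intro F
  obtain ⟨m, γ, k, h⟩ := hx (F.image (quo q n))
  refine ⟨n + m, γ, k * q ^ n, fun i hi => ?_⟩
  have := h _ (Finset.mem_image_of_mem (quo q n) hi)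
  rw [← quo_mem_box S.one_lt, quo_add_mul S.one_lt, wordAt_add, quo_add_mul S.one_lt, this.2,
    wordAt_add_mul, onSeq_iterate_apply]
  exact ⟨this.1, rfl⟩

/-- Every point of the subshift can be desubstituted `n` times within the subshift. -/
theorem exists_eq_shiftIter [Finite A] (hd : 1 ≤ d) {x : Seq d A} (hx : x ∈ S.subshift) (n : ℕ) :
    ∃ j ∈ box q n, ∃ u ∈ S.subshift, x = S.shiftIter j n u := by
  classical
  have hx' := S.mem_subshift_iff.1 hx
  let e : Idx d := fun i => q i ^ n
  have key : ∀ F : Finset (Idx d), ∃ (p : ℕ) (γ : A) (k : Idx d),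
      ∀ i ∈ F, i + k ∈ box q (n + p) ∧ S.wordAt (n + p) (i + k) γ = x i := by
    intro F
    -- Only a box of side greater than `q^n` contains two points differing by `e`; this forces `n ≤
    -- m`.
    obtain ⟨m, γ, k, h⟩ := hx' (F ∪ {0, e})
    have hm : n ≤ m := by
      by_contra hlt
      have h0 := (h 0 (by simp)).1 ⟨0, hd⟩
      have h1 := (h e (by simp)).1 ⟨0, hd⟩
      have h2 : q ⟨0, hd⟩ ^ m ≤ q ⟨0, hd⟩ ^ n :=
        pow_le_pow_right₀ (S.one_lt _).le (by omega)
      simp only [Pi.add_apply, e, Pi.zero_apply] at h0 h1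
      omega
    obtain ⟨p, rfl⟩ := Nat.exists_eq_add_of_le hm
    exact ⟨p, γ, k, fun i hi => h i (Finset.mem_union_left _ hi)⟩
  choose p γ k hk using key
  obtain ⟨U, hU⟩ := Ultrafilter.exists_le (atTop : Filter (Finset (Idx d)))
  have hbox : ∃ j ∈ box q n, ∀ᶠ F in (U : Filter (Finset (Idx d))), rmd q n (k F) = j :=
    (Ultrafilter.eventually_exists_mem_iff (box_finite q n)).1
      (Eventually.of_forall fun F => ⟨_, rmd_mem_box S.one_lt n (k F), rfl⟩)
  obtain ⟨j, hj, hjU⟩ := hbox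
  -- With the residue of `k F` frozen at `j`, the level-`p F` words recentred at the quotient of `k
  -- F` converge to the desubstitute.
  obtain ⟨u, hu⟩ := exists_ultrafilter_limit U
    fun (F : Finset (Idx d)) (z : Idx d) => S.wordAt (p F) (z + quo q n (k F)) (γ F)
  have hsub : ∀ G : Finset (Idx d), ∀ᶠ F in (U : Filter (Finset (Idx d))), G ⊆ F := fun G =>
    hU (eventually_ge_atTop G)
  have hkF : ∀ F, rmd q n (k F) = j → ∀ i, i + k F = (i + j) + quo q n (k F) * q ^ n := by
    intro F hF i
    rw [← hF, add_assoc, add_comm (rmd q n (k F)), quo_mul_add_rmd]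
  refine ⟨j, hj, u, ?_, ?_⟩
  · rw [mem_subshift_iff]
    intro G
    have h1 : ∀ᶠ F in (U : Filter (Finset (Idx d))), ∀ z ∈ G,
        S.wordAt (p F) (z + quo q n (k F)) (γ F) = u z :=
      (Finset.eventually_all G).2 fun z _ => hu z
    obtain ⟨F, hF1, hF2, hF3⟩ :=
      (h1.and (hjU.and (hsub (G.image fun g => g * q ^ n - j)))).exists
    refine ⟨p F, γ F, quo q n (k F), fun i hi => ⟨?_, hF1 i hi⟩⟩
    have := (hk F _ (hF3 (Finset.mem_image_of_mem _ hi))).1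
    rw [hkF F hF2, sub_add_cancel, ← quo_mem_box S.one_lt, ← add_mul] at this
    rwa [quo_mul S.one_lt] at this
  · funext i
    obtain ⟨F, hF1, hF2, hF3⟩ := ((hu (quo q n (i + j))).and (hjU.and (hsub {i}))).exists
    have := (hk F i (hF3 (by simp))).2
    rw [hkF F hF2, wordAt_add, wordAt_add_mul, quo_add_mul S.one_lt, hF1] at this
    rw [shiftIter, shift, onSeq_iterate_apply, this]

/-! ### Periods of iterated words -/

/-- The word `S^n(β)` has the vector `k` as a period. -/
def HasPeriod (n : ℕ) (k : Idx d) (β : A) : Prop :=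
  ∀ z ∈ box q n, z + k ∈ box q n → S.wordAt n (z + k) β = S.wordAt n z β

/-- Centring at `q^m / 2` makes the growing boxes exhaust all of `ℤ^d`, so that limits of words are
full sequences. -/
theorem _root_.QSubst.eventually_add_half_mem_box (hq : ∀ i, 1 < q i) (z : Idx d) :
    ∀ᶠ m in atTop, (z + fun i => q i ^ m / 2) ∈ box q m := by
  have h : ∀ i, ∀ᶠ m in atTop, 0 ≤ z i + q i ^ m / 2 ∧ z i + q i ^ m / 2 < q i ^ m := by
    intro i
    filter_upwards [eventually_ge_atTop (2 * (z i).natAbs + 2)] with m hm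
    have h1 : (m : ℤ) < 2 ^ m := by exact_mod_cast Nat.lt_two_pow_self
    have h2 : (2 : ℤ) ^ m ≤ q i ^ m := pow_le_pow_left₀ (by norm_num) (hq i) m
    omega
  exact eventually_all.2 h

/-- If arbitrarily large words `S^m(β)` have the period `k`, then so does a point of the
subshift. -/
theorem exists_shift_eq_self_of_frequently [Finite A] {β : A} {k : Idx d}
    (h : ∃ᶠ m in atTop, S.HasPeriod m k β) : ∃ x ∈ S.subshift, shift k x = x := by
  have : (atTop ⊓ 𝓟 {m | S.HasPeriod m k β}).NeBot := frequently_mem_iff_neBot.1 h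
  obtain ⟨U, hU⟩ := Ultrafilter.exists_le (atTop ⊓ 𝓟 {m | S.HasPeriod m k β})
  have hU1 : (U : Filter ℕ) ≤ atTop := hU.trans inf_le_left
  have hU2 : ∀ᶠ m in (U : Filter ℕ), S.HasPeriod m k β :=
    hU (mem_inf_of_right (mem_principal_self _))
  have hbox : ∀ z : Idx d, ∀ᶠ m in (U : Filter ℕ), (z + fun i => q i ^ m / 2) ∈ box q m :=
    fun z => hU1 (eventually_add_half_mem_box S.one_lt z)
  obtain ⟨y, hy⟩ := exists_ultrafilter_limit U
    fun (m : ℕ) (z : Idx d) => S.wordAt m (z + fun i => q i ^ m / 2) β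
  refine ⟨y, S.mem_subshift_iff.2 fun F => ?_, ?_⟩
  · obtain ⟨m, hm⟩ := ((Finset.eventually_all F).2 fun z _ => (hbox z).and (hy z)).exists
    exact ⟨m, β, _, hm⟩
  · funext z
    obtain ⟨m, h1, h2, h3, h4, h5⟩ :=
      (hU2.and ((hbox z).and ((hbox (z + k)).and ((hy z).and (hy (z + k)))))).exists
    rw [add_right_comm] at h3 h5
    rw [shift, ← h5, ← h4]
    exact h1 _ h2 h3

/-- A vector `k` with `|k| < q^n` moves a position to the same or a neighbouring `n`-supertile.
Whether it is a period of `S^(n+j)(β)` thus depends only on the pairs of neighbouring letters in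
`S^j(β)`, recorded by `W j`. Infinitely many levels share one value of `W`; a period at one of them
is a period at all of them. -/
theorem exists_level_period_eq_zero [Finite A] (hS : S.Aperiodic) (β : A) :
    ∃ l : ℕ, ∀ (n : ℕ) (k : Idx d), (∀ i, |k i| < q i ^ n) → S.HasPeriod (n + l) k β → k = 0 := by
  let W : ℕ → Set ((Set.Icc (-1) 1 : Set (Idx d)) × A × A) := fun j =>
    {p | ∃ a ∈ box q j, a + p.1 ∈ box q j ∧ S.wordAt j a β = p.2.1 ∧
      S.wordAt j (a + p.1) β = p.2.2}
  obtain ⟨w, hw⟩ := Finite.exists_infinite_fiber W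
  have hw' : (W ⁻¹' {w}).Infinite := Set.infinite_coe_iff.1 hw
  obtain ⟨l, hl⟩ := hw'.nonempty
  refine ⟨l, fun n k hk hper => ?_⟩
  have key : ∀ j ∈ W ⁻¹' {w}, S.HasPeriod (n + j) k β := by
    intro j hj z hz hzk
    have hWW : W j = W l := (Set.mem_singleton_iff.1 hj).trans (Set.mem_singleton_iff.1 hl).symm
    have hqp : ∀ i, 0 < q i ^ n := fun i => pow_pos (lt_trans zero_lt_one (S.one_lt i)) n
    have hε : quo q n (z + k) - quo q n z ∈ (Set.Icc (-1) 1 : Set (Idx d)) := by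
      rw [Set.mem_Icc]
      have : ∀ i, -1 ≤ (z i + k i) / q i ^ n - z i / q i ^ n ∧
          (z i + k i) / q i ^ n - z i / q i ^ n ≤ 1 := by
        intro i
        have h1 := Int.mul_ediv_add_emod (z i) (q i ^ n)
        have h2 := Int.mul_ediv_add_emod (z i + k i) (q i ^ n)
        have h3 := Int.emod_nonneg (z i) (hqp i).ne'
        have h4 := Int.emod_nonneg (z i + k i) (hqp i).ne'
        have h5 := Int.emod_lt_of_pos (z i) (hqp i)
        have h6 := Int.emod_lt_of_pos (z i + k i) (hqp i)
        have h7 := abs_lt.1 (hk i)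
        have hp := hqp i
        constructor <;> by_contra hc <;> nlinarith
      exact ⟨fun i => (this i).1, fun i => (this i).2⟩
    have hmem : ((⟨_, hε⟩, S.wordAt j (quo q n z) β, S.wordAt j (quo q n (z + k)) β) :
        (Set.Icc (-1) 1 : Set (Idx d)) × A × A) ∈ W j := by
      refine ⟨quo q n z, (quo_mem_box S.one_lt).2 hz, ?_, rfl, ?_⟩
      · simpa using (quo_mem_box S.one_lt).2 hzk
      · simp
    rw [hWW] at hmem
    obtain ⟨b, hb, hb', e1, e2⟩ := hmem
    simp only at hb' e1 e2
    set b' := b + (quo q n (z + k) - quo q n z) with hb'_def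
    have hrep : ∀ (c v : Idx d), quo q n (rmd q n v + c * q ^ n) = c := by
      intro c v
      rw [quo_add_mul S.one_lt, (quo_eq_zero_iff S.one_lt).2 (rmd_mem_box S.one_lt n v), zero_add]
    have hshift : rmd q n z + b * q ^ n + k = rmd q n (z + k) + b' * q ^ n := by
      have h1 := quo_mul_add_rmd (q := q) n z
      have h2 := quo_mul_add_rmd (q := q) n (z + k)
      rw [hb'_def]
      linear_combination h1 - h2
    -- The pair of supertiles around `z` and `z + k` is replaced by an equal pair, based at `b`,
    -- inside the word of level `n + l`.
    have := hper (rmd q n z + b * q ^ n) (by rwa [← quo_mem_box S.one_lt, hrep])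
      (by rwa [hshift, ← quo_mem_box S.one_lt, hrep])
    rw [hshift, wordAt_add, wordAt_add, hrep, hrep, e1, e2, wordAt_add_mul, wordAt_add_mul,
      wordAt_rmd, wordAt_rmd] at this
    rw [wordAt_add, wordAt_add, this]
  obtain ⟨x, hx, hxk⟩ := S.exists_shift_eq_self_of_frequently (β := β) (k := k) <| by
    rw [frequently_atTop]
    intro a
    obtain ⟨j, hj, haj⟩ := hw'.exists_gt a
    exact ⟨n + j, by omega, key j hj⟩
  exact hS x hx k hxk

/-- For some `L`, no word `S^(n + L)(β)` has a nonzero period in `(-q^n, q^n)`. -/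
theorem exists_uniform_level_period_eq_zero [Finite A] (hS : S.Aperiodic) :
    ∃ L : ℕ, ∀ (β : A) (n : ℕ) (k : Idx d), (∀ i, |k i| < q i ^ n) → S.HasPeriod (n + L) k β →
      k = 0 := by
  choose l hl using S.exists_level_period_eq_zero hS
  obtain ⟨L, hL⟩ := (Set.finite_range l).bddAbove
  refine ⟨L, fun β n k hk hper => ?_⟩
  obtain ⟨e, rfl⟩ := Nat.exists_eq_add_of_le' (hL (Set.mem_range_self β))
  refine hl β (n + e) k (fun i => (hk i).trans_le ?_) (by rwa [add_assoc])
  exact pow_le_pow_right₀ (S.one_lt i).le (Nat.le_add_right n e)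

/-! ### Recognizability -/

/-- Desubstituting `x` and `x'` a further `N - m` times changes the shift by a multiple of `q^m`.
Its quotient modulo `q^N` is then absorbed into `u'`. -/
theorem exists_lift_of_onSeq_iterate_eq_shift [Finite A] (hd : 1 ≤ d) {x x' : Seq d A}
    (hx : x ∈ S.subshift) (hx' : x' ∈ S.subshift) {m : ℕ} {k : Idx d}
    (h : S.onSeq^[m] x = shift k (S.onSeq^[m] x')) {N : ℕ} (hN : m ≤ N) :
    ∃ (u u' : Seq d A) (c : Idx d), c ∈ box q N ∧ rmd q m c = rmd q m k ∧
      S.onSeq^[N] u = shift c (S.onSeq^[N] u') := by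
  obtain ⟨p, rfl⟩ := Nat.exists_eq_add_of_le hN
  obtain ⟨a, -, u, -, rfl⟩ := S.exists_eq_shiftIter hd hx p
  obtain ⟨a', -, u', -, rfl⟩ := S.exists_eq_shiftIter hd hx' p
  set e := quo q (m + p) (k + (a' - a) * q ^ m)
  have hk' := quo_mul_add_rmd (q := q) (m + p) (k + (a' - a) * q ^ m)
  refine ⟨u, shift e u', rmd q (m + p) (k + (a' - a) * q ^ m), rmd_mem_box S.one_lt _ _, ?_, ?_⟩
  · have : rmd q (m + p) (k + (a' - a) * q ^ m) = k + (a' - a - e * q ^ p) * q ^ m := by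
      rw [pow_add] at hk'
      linear_combination hk'
    rw [this, rmd_add_mul]
  · simp only [shiftIter, onSeq_iterate_shift, shift_shift, ← Function.iterate_add_apply] at h
    have h2 := congrArg (shift (-(a * q ^ m))) h
    rw [shift_shift, shift_shift, neg_add_cancel, shift_zero] at h2
    rw [h2, onSeq_iterate_shift, shift_shift]
    congr 1
    linear_combination -hk'

/-- Both equations are read at level `n + l` at the position `z - e`. It lies in a supertile indexed
by `[-1, 0]`, where `u` and `v` agree, so the two right-hand sides agree as well. -/
theorem hasPeriod_of_onSeq_iterate_eq_shift {u u' v v' : Seq d A} {n l : ℕ} {c e : Idx d}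
    (huv : ∀ a ∈ (Set.Icc (-1) 0 : Set (Idx d)), u a = v a) (huv' : u' 0 = v' 0)
    (hu : S.onSeq^[n] u = shift c (S.onSeq^[n] u'))
    (hv : S.onSeq^[n + l] v = shift e (S.onSeq^[n + l] v')) (he : e ∈ box q (n + l)) :
    S.HasPeriod (n + l) (c * q ^ l - e) (u' 0) := by
  intro z hz hzk
  have hu2 : S.onSeq^[n + l] u = shift (c * q ^ l) (S.onSeq^[n + l] u') := by
    rw [add_comm n l, Function.iterate_add_apply, hu, onSeq_iterate_shift,
      ← Function.iterate_add_apply]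
  have hqp : ∀ i, 0 < q i ^ (n + l) := fun i => pow_pos (lt_trans zero_lt_one (S.one_lt i)) _
  have hw : quo q (n + l) (z - e) ∈ (Set.Icc (-1) 0 : Set (Idx d)) := by
    refine ⟨fun i => ?_, fun i => ?_⟩
    · refine (Int.le_ediv_iff_mul_le (hqp i)).2 ?_
      have := hz i
      have := he i
      simp only [Pi.neg_apply, Pi.one_apply, Pi.sub_apply]
      linarith
    · refine Int.lt_add_one_iff.1 ((Int.ediv_lt_iff_lt_mul (hqp i)).2 ?_)
      have := hz i
      have := he i
      simp only [Pi.zero_apply, Pi.sub_apply]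
      linarith
  have h1 := congrFun hv (z - e)
  have h2 := congrFun hu2 (z - e)
  have e2 : z - e + c * q ^ l = z + (c * q ^ l - e) := by ring
  simp only [shift, sub_add_cancel, e2, onSeq_iterate_apply] at h1 h2
  rw [(quo_eq_zero_iff S.one_lt).2 hz] at h1
  rw [(quo_eq_zero_iff S.one_lt).2 hzk, huv _ hw, h1] at h2
  rw [← h2, huv']

/-- The positions of the supertiles are determined modulo `q^m`. -/
theorem rmd_eq_zero_of_onSeq_iterate_eq_shift [Finite A] (hd : 1 ≤ d) (hS : S.Aperiodic)
    {x x' : Seq d A} (hx : x ∈ S.subshift) (hx' : x' ∈ S.subshift) {m : ℕ} {k : Idx d}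
    (h : S.onSeq^[m] x = shift k (S.onSeq^[m] x')) : rmd q m k = 0 := by
  rcases Nat.eq_zero_or_pos m with rfl | hm
  · funext i
    simp [rmd]
  obtain ⟨L, hL⟩ := S.exists_uniform_level_period_eq_zero hS
  have lift := fun t : ℕ => S.exists_lift_of_onSeq_iterate_eq_shift hd hx hx' h
    (N := (m + t * m) + L) (by omega)
  choose u u' c hc hck hu using lift
  have hcq : ∀ t, quo q (m + t * m) (c t) ∈ box q L := fun t => (quo_mem_box S.one_lt).2 (hc t)
  have : Finite (box q L) := box_finite q L
  -- The data needed to compare two levels, together with the leading part of `c t`, which takes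
  -- finitely many values because it lies in `[0, q^L)`.
  let D : ℕ → ((Set.Icc (-1) 0 : Set (Idx d)) → A) × A × box q L := fun t =>
    (fun a => u t a, u' t 0, ⟨_, hcq t⟩)
  obtain ⟨s, t, hst, hD⟩ : ∃ s t, s < t ∧ D s = D t := by
    obtain ⟨s, t, hne, hD⟩ := Finite.exists_ne_map_eq_of_infinite D
    rcases lt_or_gt_of_ne hne with h | h
    exacts [⟨s, t, h, hD⟩, ⟨t, s, h, hD.symm⟩]
  obtain ⟨r, rfl⟩ := Nat.exists_eq_add_of_lt hst
  set M := m + s * m with hM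
  have hM' : m + (s + r + 1) * m = M + (r + 1) * m := by rw [hM]; ring
  set l := (r + 1) * m with hl
  set t := s + r + 1 with ht
  simp only [D, Prod.mk.injEq, Subtype.mk.injEq] at hD
  obtain ⟨D1, D2, D3⟩ := hD
  have hut := hu t
  have hct := hc t
  rw [hM'] at D3 hut hct
  rw [show M + l + L = M + L + l by ring] at hut hct
  have hper := S.hasPeriod_of_onSeq_iterate_eq_shift (fun a ha => congrFun D1 ⟨a, ha⟩) D2 (hu s)
    hut hct
  rw [show M + L + l = M + l + L by ring] at hper
  have hz := hL _ _ _ (fun i => ?_) hper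
  -- Now `c t = c s * q^l` with `l` a positive multiple of `m`.
  · rw [← hck t, ← sub_eq_zero.1 hz, hl]
    have : c s * q ^ ((r + 1) * m) = 0 + (c s * q ^ (r * m)) * q ^ m := by
      rw [add_mul, pow_add]; ring
    rw [this, rmd_add_mul]
    exact rmd_eq_self (zero_mem_box S.one_lt m)
  -- The equal leading parts cancel, leaving a difference of two numbers in `[0, q^(M + l))`.
  · have h1 := congrFun (quo_mul_add_rmd (q := q) M (c s)) i
    have h2 := congrFun (quo_mul_add_rmd (q := q) (M + l) (c t)) i
    have h3 := rmd_mem_box S.one_lt M (c s) i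
    have h4 := rmd_mem_box S.one_lt (M + l) (c t) i
    rw [← D3] at h2
    simp only [Pi.add_apply, Pi.mul_apply, Pi.pow_apply, Pi.sub_apply] at h1 h2 ⊢
    have hql : 0 < q i ^ l := pow_pos (lt_trans zero_lt_one (S.one_lt i)) l
    have e : c s i * q i ^ l - c t i = rmd q M (c s) i * q i ^ l - rmd q (M + l) (c t) i := by
      rw [← h1, ← h2, pow_add]; ring
    have h5 : rmd q M (c s) i * q i ^ l < q i ^ (M + l) := by
      rw [pow_add]
      exact mul_lt_mul_of_pos_right h3.2 hql
    have h6 := mul_nonneg h3.1 hql.le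
    rw [e, abs_lt]
    constructor <;> linarith

/-- The relations `R n` increase among finitely many, so some `N` has `R (N + 1) ⊆ R N`. Writing
points as `T^a S^N u`, equality after one more `S` first gives equal `a`, then letters of `u` and
`u'` related by `R (N + 1)`, hence by `R N`. -/
theorem onSeq_injOn [Finite A] (hd : 1 ≤ d) (hS : S.Aperiodic) :
    Set.InjOn S.onSeq S.subshift := by
  let R : ℕ → Set (A × A) := fun n => {p | ∀ k, S.wordAt n k p.1 = S.wordAt n k p.2}
  have hR : Monotone R := monotone_nat_of_le_succ fun n p hp k => by
    rw [wordAt_succ, wordAt_succ, hp]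
  obtain ⟨N, hN⟩ : ∃ N, R (N + 1) ⊆ R N := by
    obtain ⟨s, t, hne, hD⟩ := Finite.exists_ne_map_eq_of_infinite R
    rcases lt_or_gt_of_ne hne with h | h
    · exact ⟨s, (hR h).trans hD.ge⟩
    · exact ⟨t, (hR h).trans hD.le⟩
  intro x hx x' hx' h
  obtain ⟨a, ha, u, hu, rfl⟩ := S.exists_eq_shiftIter hd hx N
  obtain ⟨a', ha', u', hu', rfl⟩ := S.exists_eq_shiftIter hd hx' N
  have hsh : ∀ b v, S.onSeq (S.shiftIter b N v) = shift (b * q) (S.onSeq^[N + 1] v) := by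
    intro b v
    have := S.onSeq_iterate_shift 1 b (S.onSeq^[N] v)
    rwa [pow_one, ← Function.iterate_add_apply, add_comm 1 N] at this
  rw [hsh, hsh] at h
  have h2 := congrArg (shift (-(a * q))) h
  rw [shift_shift, shift_shift, neg_add_cancel, shift_zero] at h2
  have h0 := S.rmd_eq_zero_of_onSeq_iterate_eq_shift hd hS hu hu' h2
  have haa : a = a' := by
    funext i
    have h3 : (-(a i * q i) + a' i * q i) % q i ^ (N + 1) = 0 := congrFun h0 i
    have h4 := Int.dvd_of_emod_eq_zero h3
    have hqi : q i ≠ 0 := (lt_trans zero_lt_one (S.one_lt i)).ne'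
    rw [pow_succ, show -(a i * q i) + a' i * q i = (a' i - a i) * q i by ring] at h4
    have h5 := Int.dvd_of_mul_dvd_mul_right hqi h4
    have h6 := Int.eq_zero_of_abs_lt_dvd h5 (by
      have := ha i
      have := ha' i
      rw [abs_lt]
      constructor <;> linarith)
    linarith
  subst haa
  rw [neg_add_cancel, shift_zero] at h2
  have h7 : S.onSeq^[N] u = S.onSeq^[N] u' := by
    funext k
    rw [onSeq_iterate_apply, onSeq_iterate_apply]
    refine hN (a := (u (quo q N k), u' (quo q N k))) (fun j => ?_) k
    have hq1 : quo q (N + 1) (rmd q (N + 1) j + quo q N k * q ^ (N + 1)) = quo q N k := by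
      rw [quo_add_mul S.one_lt, (quo_eq_zero_iff S.one_lt).2 (rmd_mem_box S.one_lt _ j), zero_add]
    -- This position has residue `j` inside the supertile over the letter at `quo q N k`.
    have := congrFun h2 (rmd q (N + 1) j + quo q N k * q ^ (N + 1))
    rw [onSeq_iterate_apply, onSeq_iterate_apply, hq1, wordAt_add_mul, wordAt_add_mul] at this
    rwa [wordAt_rmd, wordAt_rmd] at this
  rw [shiftIter, shiftIter, h7]

theorem onSeq_iterate_injOn [Finite A] (hd : 1 ≤ d) (hS : S.Aperiodic) (n : ℕ) :
    Set.InjOn S.onSeq^[n] S.subshift := by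
  have hmaps : Set.MapsTo S.onSeq S.subshift S.subshift := fun x hx =>
    S.onSeq_iterate_mem_subshift hx 1
  exact (S.onSeq_injOn hd hS).iterate hmaps n

/-- Recognizability: the `n`-th desubstitution of a point of the subshift is unique. -/
theorem shiftIter_eq_shiftIter [Finite A] (hd : 1 ≤ d) (hS : S.Aperiodic) {n : ℕ}
    {j j' : Idx d} (hj : j ∈ box q n) (hj' : j' ∈ box q n) {x x' : Seq d A}
    (hx : x ∈ S.subshift) (hx' : x' ∈ S.subshift)
    (h : S.shiftIter j n x = S.shiftIter j' n x') : j = j' ∧ x = x' := by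
  have h2 := congrArg (shift (-j)) h
  rw [shiftIter, shiftIter, shift_shift, shift_shift, neg_add_cancel, shift_zero] at h2
  have h0 := S.rmd_eq_zero_of_onSeq_iterate_eq_shift hd hS hx hx' h2
  have hjj : j = j' := by
    funext i
    have h4 := Int.dvd_of_emod_eq_zero (congrFun h0 i)
    have h6 := Int.eq_zero_of_abs_lt_dvd h4 (by
      have := hj i
      have := hj' i
      simp only [Pi.add_apply, Pi.neg_apply]
      rw [abs_lt]
      constructor <;> linarith)
    simp only [Pi.add_apply, Pi.neg_apply] at h6
    linarith
  subst hjj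
  rw [neg_add_cancel, shift_zero] at h2
  exact ⟨rfl, S.onSeq_iterate_injOn hd hS n hx hx' h2⟩

/-! ### Topology of the subshift -/

theorem shiftIter_mem_subshift {x : Seq d A} (hx : x ∈ S.subshift) (j : Idx d) (n : ℕ) :
    S.shiftIter j n x ∈ S.subshift :=
  S.shift_mem_subshift (S.onSeq_iterate_mem_subshift hx n) j

/-- Each window condition depends on finitely many coordinates, hence is clopen. -/
theorem isClosed_subshift [TopologicalSpace A] [DiscreteTopology A] : IsClosed S.subshift := by
  have h : S.subshift = ⋂ F : Finset (Idx d), (fun (x : Seq d A) (i : F) => x i) ⁻¹'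
      {y | ∃ (n : ℕ) (γ : A) (k : Idx d),
        ∀ i : F, i.1 + k ∈ box q n ∧ S.wordAt n (i.1 + k) γ = y i} := by
    ext x
    simp [mem_subshift_iff]
  rw [h]
  refine isClosed_iInter fun F => (isClosed_discrete _).preimage ?_
  exact continuous_pi fun i => continuous_apply _

theorem continuous_shiftIter_one [TopologicalSpace A] [DiscreteTopology A] (j : Idx d) :
    Continuous (S.shiftIter j 1) :=
  continuous_pi fun k =>
    (continuous_of_discreteTopology (f := S.instr (k + j))).comp (continuous_apply _)

theorem shiftIter_one_injOn [Finite A] (hd : 1 ≤ d) (hS : S.Aperiodic) (j : Idx d) :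
    Set.InjOn (S.shiftIter j 1) S.subshift := by
  intro x hx x' hx' h
  have h2 := congrArg (shift (-j)) h
  rw [shiftIter, shiftIter, shift_shift, shift_shift, neg_add_cancel, shift_zero, shift_zero] at h2
  exact S.onSeq_injOn hd hS hx hx' h2

theorem isEmbedding_restrict_shiftIter [Finite A] [TopologicalSpace A] [DiscreteTopology A]
    (hd : 1 ≤ d) (hS : S.Aperiodic) (j : Idx d)
    (h : Set.MapsTo (S.shiftIter j 1) S.subshift S.subshift) :
    Topology.IsEmbedding (h.restrict (S.shiftIter j 1) S.subshift S.subshift) := by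
  have : CompactSpace S.subshift := isCompact_iff_compactSpace.1 S.isClosed_subshift.isCompact
  refine (Continuous.isClosedEmbedding ?_ ?_).isEmbedding
  · exact (S.continuous_shiftIter_one j).restrict h
  · exact h.restrict_inj.2 (S.shiftIter_one_injOn hd hS j)

/-! ### Cylinders and their desubstitutes -/

theorem mem_cylinder_letter {α : A} {x : Seq d A} :
    x ∈ S.cylinder (Block.letter α) ↔ x ∈ S.subshift ∧ x 0 = α := by
  refine and_congr_right fun _ => ⟨fun h => h 0 α (by simp [Block.letter]), fun h k β hk => ?_⟩
  simp only [Block.letter] at hk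
  split_ifs at hk with h0
  rw [h0, h]
  exact Option.some.inj hk

theorem iUnion_iterCylinder_letter [Finite A] (hd : 1 ≤ d) (n : ℕ) :
    (⋃ p : box q n × A, S.iterCylinder p.1 n (Block.letter p.2)) = S.subshift := by
  ext x
  simp only [Set.mem_iUnion]
  constructor
  · rintro ⟨p, u, hu, rfl⟩
    exact S.shiftIter_mem_subshift hu.1 _ _
  · intro hx
    obtain ⟨j, hj, u, hu, rfl⟩ := S.exists_eq_shiftIter hd hx n
    exact ⟨(⟨j, hj⟩, u 0), u, S.mem_cylinder_letter.2 ⟨hu, rfl⟩, rfl⟩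

theorem pairwise_disjoint_iterCylinder_letter [Finite A] (hd : 1 ≤ d) (hS : S.Aperiodic) (n : ℕ) :
    Pairwise fun p p' : box q n × A =>
      Disjoint (S.iterCylinder p.1 n (Block.letter p.2))
        (S.iterCylinder p'.1 n (Block.letter p'.2)) := by
  rintro ⟨j, α⟩ ⟨j', α'⟩ hne
  refine Set.disjoint_left.2 ?_
  rintro _ ⟨u, hu, rfl⟩ ⟨u', hu', h⟩
  obtain ⟨h1, rfl⟩ := S.shiftIter_eq_shiftIter hd hS j'.2 j.2 hu'.1 hu.1 h
  have h2 := (S.mem_cylinder_letter.1 hu).2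
  have h3 := (S.mem_cylinder_letter.1 hu').2
  exact hne (Prod.ext (Subtype.ext h1.symm) (h2.symm.trans h3))

theorem shiftIter_mem_cylinder {n : ℕ} {ω : Block d A} {p : Idx d × Block d A}
    (hp : p ∈ S.desubstitutes n ω) {u : Seq d A} (hu : u ∈ S.cylinder p.2) :
    S.shiftIter p.1 n u ∈ S.cylinder ω := by
  refine ⟨S.shiftIter_mem_subshift hu.1 _ _, fun k α hk => ?_⟩
  have h := hp.2.2 k α hk
  simp only [Block.shift, onBlock_iterate_val, Option.map_eq_some_iff] at h
  obtain ⟨β, hβ, rfl⟩ := h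
  rw [shiftIter, shift, onSeq_iterate_apply, hu.2 _ _ hβ]

/-- The witness is the restriction of `u` to the supertiles that meet the translated support of `ω`.
-/
theorem exists_mem_desubstitutes {n : ℕ} {ω : Block d A} {j : Idx d} (hj : j ∈ box q n)
    {u : Seq d A} (h : ω.ExtSeq (S.shiftIter j n u)) :
    ∃ η : Block d A, (j, η) ∈ S.desubstitutes n ω ∧ η.ExtSeq u := by
  classical
  let s : Set (Idx d) := (fun k => quo q n (j + k)) '' ω.supp
  have hs : s.Finite := ω.finite_dom.image _
  have hval : ∀ k, (if k ∈ s then some (u k) else none : Option A) ≠ none ↔ k ∈ s := by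
    intro k
    split_ifs with hk <;> simp [hk]
  let η : Block d A := ⟨fun k => if k ∈ s then some (u k) else none,
    hs.subset fun k hk => (hval k).1 hk⟩
  refine ⟨η, ⟨hj, Set.ext hval, fun k α hk => ?_⟩, fun k α hk => ?_⟩
  · have hks : quo q n (k + j) ∈ s := ⟨k, by simp [Block.supp, hk], by rw [add_comm]⟩
    have := h k α hk
    rw [shiftIter, shift, onSeq_iterate_apply] at this
    simp [Block.shift, onBlock_iterate_val, η, hks, this]
  · simp only [η] at hk
    split_ifs at hk
    exact Option.some.inj hk

theorem cylinder_eq_biUnion_iterCylinder [Finite A] (hd : 1 ≤ d) (n : ℕ) (ω : Block d A) :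
    S.cylinder ω = ⋃ p ∈ S.desubstitutes n ω, S.iterCylinder p.1 n p.2 := by
  ext x
  simp only [Set.mem_iUnion]
  constructor
  · intro hx
    obtain ⟨j, hj, u, hu, rfl⟩ := S.exists_eq_shiftIter hd hx.1 n
    obtain ⟨η, hη, hηu⟩ := S.exists_mem_desubstitutes hj hx.2
    exact ⟨(j, η), hη, u, ⟨hu, hηu⟩, rfl⟩
  · rintro ⟨p, hp, u, hu, rfl⟩
    exact S.shiftIter_mem_cylinder hp hu

theorem _root_.QSubst.Block.eq_of_extSeq {ω η : Block d A} {x : Seq d A} (hω : ω.ExtSeq x)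
    (hη : η.ExtSeq x) (h : ω.supp = η.supp) : ω = η := by
  ext k α
  have hk := Set.ext_iff.1 h k
  simp only [Block.supp, Set.mem_ofPred_eq, Option.ne_none_iff_exists'] at hk
  constructor
  · intro e
    obtain ⟨β, hβ⟩ := hk.1 ⟨α, e⟩
    rw [hβ, ← hω k α e, ← hη k β hβ]
  · intro e
    obtain ⟨β, hβ⟩ := hk.2 ⟨α, e⟩
    rw [hβ, ← hη k α e, ← hω k β hβ]

/-- A common point determines `j` and `u`; both blocks are then restrictions of `u` to the same
support. -/
theorem pairwiseDisjoint_iterCylinder [Finite A] (hd : 1 ≤ d) (hS : S.Aperiodic) (n : ℕ)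
    (ω : Block d A) :
    (S.desubstitutes n ω).PairwiseDisjoint fun p => S.iterCylinder p.1 n p.2 := by
  rintro ⟨j, η⟩ hp ⟨j', η'⟩ hp' hne
  refine Set.disjoint_left.2 ?_
  rintro _ ⟨u, hu, rfl⟩ ⟨u', hu', h⟩
  obtain ⟨h1, rfl⟩ := S.shiftIter_eq_shiftIter hd hS hp'.1 hp.1 hu'.1 hu.1 h
  simp only at h1
  subst h1
  exact hne (Prod.ext rfl (Block.eq_of_extSeq hu.2 hu'.2 (hp.2.1.trans hp'.2.1.symm)))

end QSubstitution

end QSubst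

theorem mainTheorem10 {d : ℕ} (hd : 1 ≤ d) {A : Type*} [Finite A] [Nontrivial A]
    [TopologicalSpace A] [DiscreteTopology A] {q : QSubst.Idx d}
    (S : QSubst.QSubstitution q A) (hS : S.Aperiodic) :
    -- every `T^j S` maps `X_S` into itself and is a topological embedding of `X_S` into itself
    (∀ j : QSubst.Idx d, ∃ h : Set.MapsTo (S.shiftIter j 1) S.subshift S.subshift,
      Topology.IsEmbedding (h.restrict (S.shiftIter j 1) S.subshift S.subshift)) ∧
    (∀ n : ℕ,
      -- the `n`-th iterated initial cylinders partition `X_S`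
      ((⋃ p : QSubst.box q n × A, S.iterCylinder p.1 n (QSubst.Block.letter p.2)) = S.subshift ∧
        Pairwise (fun p p' : QSubst.box q n × A =>
          Disjoint (S.iterCylinder p.1 n (QSubst.Block.letter p.2))
            (S.iterCylinder p'.1 n (QSubst.Block.letter p'.2))) ∧
        ∀ p : QSubst.box q n × A,
          (S.iterCylinder p.1 n (QSubst.Block.letter p.2)).Nonempty ↔
            (S.cylinder (QSubst.Block.letter p.2)).Nonempty) ∧
      -- every cylinder is the disjoint union of the iterates of its `n`-th desubstitutes
      ∀ ω : QSubst.Block d A,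
        S.cylinder ω = ⋃ p ∈ S.desubstitutes n ω, S.iterCylinder p.1 n p.2 ∧
        (S.desubstitutes n ω).PairwiseDisjoint (fun p => S.iterCylinder p.1 n p.2)) := by
  exact ⟨fun j => ⟨fun _ hx => S.shiftIter_mem_subshift hx j 1,
      S.isEmbedding_restrict_shiftIter hd hS j _⟩,
    fun n => ⟨⟨S.iUnion_iterCylinder_letter hd n, S.pairwise_disjoint_iterCylinder_letter hd hS n,
      fun _ => Set.image_nonempty⟩,
      fun ω => ⟨S.cylinder_eq_biUnion_iterCylinder hd n ω,
        S.pairwiseDisjoint_iterCylinder hd hS n ω⟩⟩⟩
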